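/- **Theorem (Universal approximation on whole space).** Fix activation functions $\sigma,\tau:\mathbb R\to\mathbb R$, each Lipschitz and not a polynomial (for instance both equal to the ReLU). *Neural networks.* A neural network with activation $\tau$ is a fully connected feed-forward map $\mathbb R^p\to\mathbb R^q$ with at least one hidden layer of units $x\mapsto\tau(Ax+b)$ ($\tau$ acting on each coordinate) and an affine output layer. A shallow ReLU network $s:\mathbb R\to\mathbb R$ is a map $s(t)=c_0+\sum_{i=1}^m c_i\max(a_it+b_i,0)$ with real coefficients. *Neural operators.* Let $\Omega\subset\mathbb R^d$ and $\Omega'\subset\mathbb R^{d'}$ be measurable. A hidden layer from functions $f:\Omega\to\mathbb R^{k}$ to functions on a set $\tilde\Omega$ with values in $\mathbb R^{l}$ is a map $$\mathcal L(f)(y)=\sigma\Bigl(W f(y)+b+\sum_{m=1}^{M}\langle T_mf,\psi_m\rangle\,\phi_m(y)\Bigr),\qquad y\in\tilde\Omega,\qquad \langle g,\psi\rangle=\int_\Omega g(x)\cdot\psi(x)\,dx,$$ where $\sigma$ acts on each coordinate, $W\in\mathbb R^{l\times k}$, $b\in\mathbb R^{l}$, $T_m\in\mathbb R^{k\times k}$,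 and $\psi_m:\Omega\to\mathbb R^{k}$ and $\phi_m:\tilde\Omega\to\mathbb R^{l}$ are continuous and bounded; if $\tilde\Omega\ne\Omega$, so that $f(y)$ need not make sense, the term $Wf(y)$ is omitted. A neural operator $\Psi_0:L^1(\Omega)\to L^1(\Omega')$ is a map of the form $$\Psi_0=\mathcal Q\circ\mathcal L_L\circ\cdots\circ\mathcal L_1\circ\mathcal N,\qquad L\ge 1,$$ where $\mathcal N(f)(x)=N(x,f(x))$ for a neural network $N:\mathbb R^{d+1}\to\mathbb R^{k_0}$ with activation $\tau$; $\mathcal L_1,\dots,\mathcal L_{L-1}$ are hidden layers from functions on $\Omega$ to functions on $\Omega$; $\mathcal L_L$ is a hidden layer from functions on $\Omega$ to functions on $\Omega'$; and $\mathcal Q(g)(y)=Q(y,g(y))$ for a neural network $Q:\mathbb R^{d'+k_L}\to\mathbb R$ with activation $\tau$. The numbers of components $k_0,\dots,k_L$ are arbitrary. *Full space neural operators.* A full space neural operator with truncation sets $\Omega$ and $\Omega'$ is a map $\Psi:L^1(\mathbb R^d)\to L^1(\mathbb R^{d'})$ of the form $$\Psi=\mathcal Z_{\Omega'}\circ\Psi_0\circ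 S\circ\mathcal R_\Omega ,$$ where $\mathcal R_\Omega:L^1(\mathbb R^d)\to L^1(\Omega)$ is restriction to $\Omega$, $S:L^1(\Omega)\to L^1(\Omega)$ is given by $S(f)(x)=s(f(x))$ for a shallow ReLU network $s:\mathbb R\to\mathbb R$, $\Psi_0:L^1(\Omega)\to L^1(\Omega')$ is a neural operator, and $\mathcal Z_{\Omega'}:L^1(\Omega')\to L^1(\mathbb R^{d'})$ is extension by zero. *Statement.* Let $F^\star:L^1(\mathbb R^d)\to L^1(\mathbb R^{d'})$ be continuous, let $K\subset L^1(\mathbb R^d)$ be compact, and let $\varepsilon>0$. Then there exist $R>0$, $R'>0$ and a full space neural operator $\Psi:L^1(\mathbb R^d)\to L^1(\mathbb R^{d'})$ with truncation sets $\Omega=(-R,R)^d$ and $\Omega'=(-R',R')^{d'}$ such that $$\sup_{\rho\in K}\|F^\star(\rho)-\Psi(\rho)\|_{L^1(\mathbb R^{d'})}\le\varepsilon .$$ -/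

import Mathlib

open MeasureTheory
open scoped Matrix

namespace NeuralOp

noncomputable section

/-! ### Function spaces

Points of `ℝⁿ` are functions `Fin n → ℝ`; only the topology and the Lebesgue measure
`volume` of `ℝⁿ` are used. -/

/-- The real Banach space `L¹(ℝⁿ)`. -/
abbrev L1 (n : ℕ) : Type := Lp ℝ 1 (volume : Measure (Fin n → ℝ))

/-- The real Banach space `L¹(Ω)`, with respect to Lebesgue measure on `Ω ⊆ ℝⁿ`. -/
abbrev L1On {n : ℕ} (Ω : Set (Fin n → ℝ)) : Type := Lp ℝ 1 (volume.restrict Ω)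

/-- The open cube `(-R, R)ⁿ`. -/
def cube (n : ℕ) (R : ℝ) : Set (Fin n → ℝ) := Set.univ.pi fun _ => Set.Ioo (-R) R

theorem measurableSet_cube (n : ℕ) (R : ℝ) : MeasurableSet (cube n R) :=
  MeasurableSet.univ_pi fun _ => measurableSet_Ioo

/-- The restriction operator `L¹(ℝⁿ) → L¹(Ω)`, `f ↦ f|_Ω`. -/
def restriction {n : ℕ} (Ω : Set (Fin n → ℝ)) (f : L1 n) : L1On Ω :=
  LpToLpRestrictCLM (Fin n → ℝ) ℝ ℝ volume 1 Ω f

/-- The zero extension operator `L¹(Ω) → L¹(ℝⁿ)`. -/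
def zeroExtension {n : ℕ} {Ω : Set (Fin n → ℝ)} (hΩ : MeasurableSet Ω) (f : L1On Ω) : L1 n :=
  ((memLp_indicator_iff_restrict hΩ).2 (Lp.memLp f)).toLp (Ω.indicator f)

/-! ### Neural networks -/

/-- A Lipschitz function `ℝ → ℝ` that is not a polynomial. -/
def IsActivation (σ : ℝ → ℝ) : Prop :=
  (∃ C, LipschitzWith C σ) ∧ ¬ ∃ p : Polynomial ℝ, ∀ t, σ t = p.eval t

/-- The layer `x ↦ τ (A x + b)` of a network, `τ` acting on each coordinate. -/
def denseLayer (τ : ℝ → ℝ) {p q : ℕ} (A : Matrix (Fin q) (Fin p) ℝ) (b : Fin q → ℝ)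
    (x : Fin p → ℝ) : Fin q → ℝ := fun i => τ ((A *ᵥ x + b) i)

/-- `N : ℝᵖ → ℝ^q` is a fully connected neural network with activation `τ` and at least one
layer of hidden units; the output layer is affine. -/
inductive IsNeuralNetwork (τ : ℝ → ℝ) {q : ℕ} : {p : ℕ} → ((Fin p → ℝ) → (Fin q → ℝ)) → Prop
  | shallow {p m : ℕ} (A : Matrix (Fin m) (Fin p) ℝ) (b : Fin m → ℝ)
      (C : Matrix (Fin q) (Fin m) ℝ) (c : Fin q → ℝ) :
      IsNeuralNetwork τ (fun x => C *ᵥ denseLayer τ A b x + c)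
  | deepen {p m : ℕ} (A : Matrix (Fin m) (Fin p) ℝ) (b : Fin m → ℝ)
      {N : (Fin m → ℝ) → (Fin q → ℝ)} (hN : IsNeuralNetwork τ N) :
      IsNeuralNetwork τ (fun x => N (denseLayer τ A b x))

/-- `s : ℝ → ℝ` is a shallow (one layer of hidden units) ReLU neural network. -/
def IsShallowReLU (s : ℝ → ℝ) : Prop :=
  ∃ (m : ℕ) (a b c : Fin m → ℝ) (c₀ : ℝ), ∀ t, s t = ∑ i, c i * max (a i * t + b i) 0 + c₀

/-! ### Layers of a neural operator

Layers act on functions that are written as total functions `ℝⁿ → ℝᵏ`.  For a layer between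
functions on `Ω` and functions on `Ω'`, only the values of the input on `Ω` are used to compute
the values of the output on `Ω'`. -/

/-- Functions of `n` real variables with `k` real components. -/
abbrev Field (n k : ℕ) : Type := (Fin n → ℝ) → (Fin k → ℝ)

/-- `g` is continuous and bounded on `Ω`. -/
def IsBddContOn {n k : ℕ} (Ω : Set (Fin n → ℝ)) (g : Field n k) : Prop :=
  ContinuousOn g Ω ∧ ∃ C : ℝ, ∀ x ∈ Ω, ‖g x‖ ≤ C

/-- The lifting layer `f ↦ (x ↦ N (x, f x))`; the projection layer has the same form. -/
def pointwiseLayer {n p k : ℕ} (N : (Fin (n + p) → ℝ) → (Fin k → ℝ)) (f : Field n p) :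
    Field n k := fun x => N (Fin.append x (f x))

/-- The local linear term of a hidden layer from functions on `Ω` to functions on `Ω'`: a weight
matrix `x ↦ W (f x)` if the two domains are the same, and in any case the term may be zero
(the only choice when `f` is not defined on `Ω'`). -/
inductive IsLocalTerm {n k : ℕ} (Ω : Set (Fin n → ℝ)) :
    {n' k' : ℕ} → Set (Fin n' → ℝ) → (Field n k → Field n' k') → Prop
  | zero {n' k' : ℕ} (Ω' : Set (Fin n' → ℝ)) :
      IsLocalTerm Ω Ω' (fun (_ : Field n k) (_ : Fin n' → ℝ) => (0 : Fin k' → ℝ))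
  | weight {k' : ℕ} (W : Matrix (Fin k') (Fin k) ℝ) :
      IsLocalTerm Ω Ω (fun (f : Field n k) (x : Fin n → ℝ) => W *ᵥ f x)

/-- The nonlocal term `y ↦ ∑ m, ⟨T m f, ψ m⟩ φ m y`, with the pairing
`⟨g, ψ⟩ = ∫_Ω g(x) · ψ(x) dx`. -/
def nonlocalTerm {n k n' k' M : ℕ} (Ω : Set (Fin n → ℝ))
    (T : Fin M → Matrix (Fin k) (Fin k) ℝ) (ψ : Fin M → Field n k) (φ : Fin M → Field n' k')
    (f : Field n k) : Field n' k' :=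
  fun y => ∑ m, (∫ x in Ω, (T m *ᵥ f x) ⬝ᵥ ψ m x) • φ m y

/-- Hidden layers with activation `σ`, from `k`-component functions on `Ω` to `k'`-component
functions on `Ω'`; the encoding functions `ψ m` and the decoding functions `φ m` are continuous
and bounded. -/
def IsHiddenLayer (σ : ℝ → ℝ) {n k n' k' : ℕ} (Ω : Set (Fin n → ℝ)) (Ω' : Set (Fin n' → ℝ))
    (L : Field n k → Field n' k') : Prop :=
  ∃ (A : Field n k → Field n' k') (b : Fin k' → ℝ) (M : ℕ)
    (T : Fin M → Matrix (Fin k) (Fin k) ℝ) (ψ : Fin M → Field n k) (φ : Fin M → Field n' k'),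
    IsLocalTerm Ω Ω' A ∧ (∀ m, IsBddContOn Ω (ψ m)) ∧ (∀ m, IsBddContOn Ω' (φ m)) ∧
    L = fun f y i => σ ((A f y + b + nonlocalTerm Ω T ψ φ f y) i)

/-- Compositions of finitely many, and at least one, hidden layers: all but the last one act
between functions on `Ω`, and the last one produces functions on `Ω'`. -/
inductive IsHiddenStack (σ : ℝ → ℝ) {n n' k' : ℕ} (Ω : Set (Fin n → ℝ))
    (Ω' : Set (Fin n' → ℝ)) : {k : ℕ} → (Field n k → Field n' k') → Prop
  | last {k : ℕ} {L : Field n k → Field n' k'} (hL : IsHiddenLayer σ Ω Ω' L) :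
      IsHiddenStack σ Ω Ω' L
  | cons {k l : ℕ} {L : Field n k → Field n l} {H : Field n l → Field n' k'}
      (hL : IsHiddenLayer σ Ω Ω L) (hH : IsHiddenStack σ Ω Ω' H) :
      IsHiddenStack σ Ω Ω' (H ∘ L)

/-! ### Neural operators -/

/-- `Ψ : L¹(Ω) → L¹(Ω')` is a neural operator: a lifting layer, followed by hidden layers with
activation `σ`, followed by a projection layer; the networks of the lifting and of the projection
layer have activation `τ`. -/
def IsNeuralOperator (σ τ : ℝ → ℝ) {n n' : ℕ} (Ω : Set (Fin n → ℝ)) (Ω' : Set (Fin n' → ℝ))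
    (Ψ : L1On Ω → L1On Ω') : Prop :=
  ∃ (k k' : ℕ) (N : (Fin (n + 1) → ℝ) → (Fin k → ℝ)) (H : Field n k → Field n' k')
    (Q : (Fin (n' + k') → ℝ) → (Fin 1 → ℝ)),
    IsNeuralNetwork τ N ∧ IsHiddenStack σ Ω Ω' H ∧ IsNeuralNetwork τ Q ∧
    ∀ f : L1On Ω, ∀ᵐ y ∂(volume.restrict Ω'),
      Ψ f y = pointwiseLayer Q (H (pointwiseLayer N (fun x _ => f x))) y 0

/-- `Ψ : L¹(ℝⁿ) → L¹(ℝⁿ')` is a full space neural operator with truncation sets `Ω`, `Ω'`: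
restriction to `Ω`, then a shallow ReLU network acting pointwise, then a neural operator
`L¹(Ω) → L¹(Ω')`, then extension by zero. -/
def IsFullNeuralOperator (σ τ : ℝ → ℝ) {n n' : ℕ} (Ω : Set (Fin n → ℝ))
    {Ω' : Set (Fin n' → ℝ)} (hΩ' : MeasurableSet Ω') (Ψ : L1 n → L1 n') : Prop :=
  ∃ (s : ℝ → ℝ) (S : L1On Ω → L1On Ω) (Ψ₀ : L1On Ω → L1On Ω'),
    IsShallowReLU s ∧ (∀ f : L1On Ω, ∀ᵐ x ∂(volume.restrict Ω), S f x = s (f x)) ∧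
    IsNeuralOperator σ τ Ω Ω' Ψ₀ ∧
    Ψ = zeroExtension hΩ' ∘ Ψ₀ ∘ S ∘ restriction Ω

end

end NeuralOp

/-! Since `F '' K` is compact, one cube Ω' carries almost all the mass of every `F ρ`, `ρ ∈ K`. On
Ω', density of bounded continuous functions in L¹ and a partition of unity replace `F` by a
continuous map `g` from `K` to bounded continuous functions (`exists_continuous_approx`). Then `(ρ,
y) ↦ g ρ y` is a continuous real function on the compact space `K × [-R', R']^d'`. The coordinates
of `y` and the neurons `σ (a ∫ρψ + b)` separate the points of this space, so a shallow τ-network fed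
with finitely many of them approximates it uniformly (`exists_pairNet_approx`). This is a projection
network after a single hidden layer with constant decoding functions.

The hidden layer sees the clipped and lifted input instead of `ρ`, so the lifting network has to
imitate the identity. It can do so only on a bounded interval, which is why values are first clipped
to `[-M, M]`. By Dini's theorem clipping costs little in L¹ uniformly on `K`, and a cube containing
the supports of the `ψ` loses nothing (`exists_scalarNet_pairing_approx`). The projection network is
chosen first: its Lipschitz constant in the pairings dictates how accurate they must be.

Density of shallow networks is proved by duality in one variable. A functional `l` killing all `f (a
x + b)` kills the same expressions with `f` mollified; differentiating `k` times in `a` at `a = 0`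
gives `l (x ^ k) * (φ ⋆ f)⁽ᵏ⁾(b) = 0`. As `f` is not a polynomial, the second factor is not always
zero, so `l (x ^ k) = 0`, and Weierstrass applies. On a general compact space, exponentials of the
inputs span a point-separating algebra, and the one-variable result approximates `exp`. -/

/-! ### Universal approximation in one variable -/

namespace UniversalApprox

open Filter Topology Polynomial
open scoped Convolution

/-- A point outside a closed subspace is detected by a continuous functional vanishing on it. -/
theorem exists_strongDual_of_notMem {E : Type*} [NormedAddCommGroup E] [NormedSpace ℝ E]
    {V : Submodule ℝ E} (hV : IsClosed (V : Set E)) {x : E} (hx : x ∉ V) :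
    ∃ l : E →L[ℝ] ℝ, (∀ v ∈ V, l v = 0) ∧ l x ≠ 0 := by
  obtain ⟨l, u, hlx, hlv⟩ := geometric_hahn_banach_point_closed V.convex hV hx
  have h0 : ∀ v ∈ V, l v = 0 := by
    intro v hv
    by_contra hne
    have h := hlv ((u / l v) • v) (V.smul_mem _ hv)
    rw [map_smul, smul_eq_mul, div_mul_cancel₀ _ hne] at h
    exact lt_irrefl _ h
  refine ⟨l, h0, fun h => ?_⟩
  have := hlv 0 V.zero_mem
  simp only [map_zero, h] at this hlx
  linarith

/-- A smooth function with vanishing `k`-th derivative is a polynomial of degree less than `k`. -/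
theorem exists_polynomial_of_iteratedDeriv_eq_zero (k : ℕ) : ∀ {g : ℝ → ℝ},
    ContDiff ℝ (⊤ : ℕ∞) g → (∀ t, iteratedDeriv k g t = 0) →
    ∃ c : ℕ → ℝ, ∀ t, g t = ∑ i ∈ Finset.range k, c i * t ^ i := by
  induction k with
  | zero => intro g _ h; exact ⟨0, fun t => by simpa using h t⟩
  | succ k ih =>
    intro g hg h
    obtain ⟨c, hc⟩ := ih (g := deriv g) ((contDiff_infty_iff_deriv (𝕜 := ℝ)).1 hg).2
      (fun t => by rw [← h t, iteratedDeriv_succ'])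
    have hd : Differentiable ℝ g := hg.differentiable (by simp)
    have hP : ∀ t, HasDerivAt (fun t => ∑ i ∈ Finset.range k, c i / (i + 1) * t ^ (i + 1))
        (deriv g t) t := by
      intro t
      rw [hc t]
      refine HasDerivAt.fun_sum fun i _ => ?_
      refine ((hasDerivAt_pow (i + 1) t).const_mul (c i / (i + 1))).congr_deriv ?_
      have : (i : ℝ) + 1 ≠ 0 := by positivity
      push_cast
      field_simp
    have hconst : ∀ t, g t - ∑ i ∈ Finset.range k, c i / (i + 1) * t ^ (i + 1) = g 0 := by
      intro t
      have := is_const_of_deriv_eq_zero (𝕜 := ℝ)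
        (f := fun t => g t - ∑ i ∈ Finset.range k, c i / (i + 1) * t ^ (i + 1))
        (fun s => ((hd s).hasDerivAt.sub (hP s)).differentiableAt)
        (fun s => by simpa using ((hd s).hasDerivAt.fun_sub (hP s)).deriv) t 0
      simpa using this
    refine ⟨fun i => if i = 0 then g 0 else c (i - 1) / i, fun t => ?_⟩
    rw [Finset.sum_range_succ']
    have := hconst t
    simp only [Nat.add_eq_zero_iff, one_ne_zero, and_false, if_false, Nat.add_sub_cancel,
      Nat.cast_add, Nat.cast_one, if_true, pow_zero, mul_one]
    linarith

/-- A pointwise limit of polynomials of degree less than `k` is a polynomial. -/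
theorem exists_polynomial_of_tendsto (k : ℕ) {f : ℕ → ℝ → ℝ} {g : ℝ → ℝ}
    (hf : ∀ n, ∃ c : ℕ → ℝ, ∀ t, f n t = ∑ i ∈ Finset.range k, c i * t ^ i)
    (hfg : ∀ t, Tendsto (fun n => f n t) atTop (𝓝 (g t))) :
    ∃ p : ℝ[X], ∀ t, g t = p.eval t := by
  have hinj : Set.InjOn (fun i : ℕ => (i : ℝ)) (Finset.range k : Set ℕ) :=
    fun i _ j _ h => Nat.cast_injective h
  -- Lagrange interpolation at `0, …, k - 1` expresses the polynomial through `k` of its values, and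
  -- this formula survives pointwise limits.
  have key : ∀ n t, f n t
      = ∑ i ∈ Finset.range k, f n i * (Lagrange.basis (Finset.range k) (fun i : ℕ => (i : ℝ)) i).eval t := by
    intro n t
    obtain ⟨c, hc⟩ := hf n
    set p : ℝ[X] := ∑ i ∈ Finset.range k, C (c i) * X ^ i with hp
    have he : ∀ t, f n t = p.eval t := fun t => by simp [hp, hc, eval_finsetSum]
    have hdeg : p.degree < (Finset.range k).card := by
      rw [Finset.card_range, hp]
      refine (degree_sum_le _ _).trans_lt ((Finset.sup_lt_iff ?_).2 fun i hi => ?_)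
      · exact WithBot.bot_lt_coe _
      · refine (degree_C_mul_X_pow_le _ _).trans_lt ?_
        exact_mod_cast Finset.mem_range.1 hi
    have h := congrArg (eval t) (Lagrange.eq_interpolate hinj hdeg)
    rw [he t, h, Lagrange.interpolate_apply, eval_finsetSum]
    simp [he]
  refine ⟨∑ i ∈ Finset.range k,
    C (g i) * Lagrange.basis (Finset.range k) (fun i : ℕ => (i : ℝ)) i, fun t => ?_⟩
  refine tendsto_nhds_unique (hfg t) ?_
  simp only [eval_finsetSum, eval_mul, eval_C]
  have : (fun n => f n t) = fun n => ∑ i ∈ Finset.range k,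
      f n i * (Lagrange.basis (Finset.range k) (fun i : ℕ => (i : ℝ)) i).eval t :=
    funext fun n => key n t
  rw [this]
  exact tendsto_finsetSum _ fun i _ => (hfg i).mul_const _

/-- A continuous function all of whose mollifications have vanishing `k`-th derivative is a
polynomial. -/
theorem exists_polynomial_of_convolution (k : ℕ) {f : ℝ → ℝ} (hf : Continuous f)
    (h : ∀ φ : ℝ → ℝ, ContDiff ℝ (⊤ : ℕ∞) φ → HasCompactSupport φ →
      ∀ t, iteratedDeriv k (φ ⋆[ContinuousLinearMap.lsmul ℝ ℝ, volume] f) t = 0) :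
    ∃ p : ℝ[X], ∀ t, f t = p.eval t := by
  let φ : ℕ → ContDiffBump (0 : ℝ) := fun n =>
    ⟨1 / (n + 1) / 2, 1 / (n + 1), by positivity, half_lt_self (by positivity)⟩
  refine exists_polynomial_of_tendsto k
    (f := fun n => (φ n).normed volume ⋆[ContinuousLinearMap.lsmul ℝ ℝ, volume] f)
    (fun n => ?_) (fun t => ?_)
  · refine exists_polynomial_of_iteratedDeriv_eq_zero k ?_
      (h _ (φ n).contDiff_normed (φ n).hasCompactSupport_normed)
    exact (φ n).hasCompactSupport_normed.contDiff_convolution_left _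
      (φ n).contDiff_normed hf.locallyIntegrable
  · exact ContDiffBump.convolution_tendsto_right_of_continuous
      tendsto_one_div_add_atTop_nhds_zero_nat hf t

/-! ### Functionals annihilating ridge functions -/

section Functional

variable {X : Set ℝ}

/-- The function `x ↦ x ^ k * g (a * x + b)` on `X`. -/
def ridge (X : Set ℝ) (k : ℕ) (g : C(ℝ, ℝ)) (a b : ℝ) : C(X, ℝ) :=
  ⟨fun x => (x : ℝ) ^ k * g (a * x + b), by fun_prop⟩

theorem continuous_ridge (k : ℕ) (g : C(ℝ, ℝ)) {a b : ℝ → ℝ} (ha : Continuous a)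
    (hb : Continuous b) : Continuous fun s => ridge X k g (a s) (b s) :=
  ContinuousMap.continuous_of_continuous_uncurry _ (by
    unfold ridge Function.uncurry
    simp only [ContinuousMap.coe_mk]
    fun_prop)

/-- If a functional kills all `x ^ k * g (a * x + b)` then it also kills all
`x ^ (k + 1) * g' (a * x + b)`. -/
theorem apply_ridge_deriv_eq_zero [CompactSpace X] (l : C(X, ℝ) →L[ℝ] ℝ) (k : ℕ) {g g' : C(ℝ, ℝ)}
    (hg : ∀ t, HasDerivAt g (g' t) t) {b : ℝ} (h : ∀ a, l (ridge X k g a b) = 0) (a : ℝ) :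
    l (ridge X (k + 1) g' a b) = 0 := by
  have hc : Continuous fun s => ridge X (k + 1) g' s b :=
    continuous_ridge _ _ continuous_id continuous_const
  -- The derivative in `a` is used in integrated form: the identity in `C(X, ℝ)` can be checked
  -- pointwise, and `l` commutes with the integral.
  have key : ∀ c, ∫ s in (0 : ℝ)..c, ridge X (k + 1) g' s b
      = ridge X k g c b - ridge X k g 0 b := by
    intro c
    ext x
    have h1 := (ContinuousMap.evalCLM ℝ x).intervalIntegral_comp_comm
      (hc.intervalIntegrable (μ := volume) 0 c)
    have h2 : ∫ s in (0 : ℝ)..c, (ridge X (k + 1) g' s b) x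
        = (x : ℝ) ^ k * g (c * x + b) - (x : ℝ) ^ k * g (0 * x + b) := by
      refine intervalIntegral.integral_eq_sub_of_hasDerivAt
        (f := fun s => (x : ℝ) ^ k * g (s * x + b)) (fun s _ => ?_) ?_
      · have h3 : HasDerivAt (fun s : ℝ => s * (x : ℝ) + b) x s := by
          simpa using ((hasDerivAt_id s).mul_const (x : ℝ)).add_const b
        refine (((hg (s * x + b)).comp s h3).const_mul ((x : ℝ) ^ k)).congr_deriv ?_
        simp only [ridge, ContinuousMap.coe_mk]
        ring
      · refine Continuous.intervalIntegrable ?_ _ _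
        simp only [ridge, ContinuousMap.coe_mk]
        fun_prop
    simp only [ContinuousMap.evalCLM_apply] at h1
    rw [← h1, h2]
    simp [ridge]
  have hl : ∀ c, ∫ s in (0 : ℝ)..c, l (ridge X (k + 1) g' s b) = 0 := by
    intro c
    rw [l.intervalIntegral_comp_comm (hc.intervalIntegrable (μ := volume) 0 c), key, map_sub,
      h, h, sub_zero]
  have hd := (l.continuous.comp hc).deriv_integral _ 0 a
  simp only [Function.comp_apply, hl, deriv_const] at hd
  exact hd.symm

/-- Each differentiation in `a` raises the exponent by one, so the induction on `j` runs over all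
`k` and `g`. At `a = 0` the conclusion isolates the value of `l` on a monomial. -/
theorem apply_ridge_iteratedDeriv_eq_zero [CompactSpace X] (l : C(X, ℝ) →L[ℝ] ℝ) {b : ℝ} (j : ℕ) :
    ∀ (k : ℕ) (g : C(ℝ, ℝ)) (_ : ContDiff ℝ (⊤ : ℕ∞) g) (_ : ∀ a, l (ridge X k g a b) = 0)
      (g' : C(ℝ, ℝ)) (_ : ∀ t, g' t = iteratedDeriv j g t) (a : ℝ),
      l (ridge X (k + j) g' a b) = 0 := by
  induction j with
  | zero =>
    intro k g _ h g' hg' a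
    have : g' = g := by ext t; simpa using hg' t
    simpa [this] using h a
  | succ j ih =>
    intro k g hg h g' hg' a
    have hg1 := (contDiff_infty_iff_deriv (𝕜 := ℝ)).1 hg
    have := ih (k + 1) ⟨deriv g, hg1.2.continuous⟩ hg1.2
      (fun a => apply_ridge_deriv_eq_zero l k (fun t => (hg1.1 t).hasDerivAt) h a) g'
      (fun t => by rw [hg' t, iteratedDeriv_succ']; rfl) a
    rwa [show k + (j + 1) = k + 1 + j by ring]

/-- A functional that kills all `f (a * x + b)` also kills all mollifications of those. -/
theorem apply_ridge_convolution_eq_zero [CompactSpace X] (l : C(X, ℝ) →L[ℝ] ℝ) {f : C(ℝ, ℝ)}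
    (h : ∀ a b, l (ridge X 0 f a b) = 0) {φ : ℝ → ℝ} (hφ : Continuous φ)
    (hφc : HasCompactSupport φ) {g : C(ℝ, ℝ)}
    (hg : ∀ t, g t = (φ ⋆[ContinuousLinearMap.lsmul ℝ ℝ, volume] f) t) (a b : ℝ) :
    l (ridge X 0 g a b) = 0 := by
  have hc : Continuous fun t => φ t • ridge X 0 f a (b - t) :=
    hφ.smul (continuous_ridge _ _ continuous_const (continuous_const.sub continuous_id))
  have hi : Integrable (fun t => φ t • ridge X 0 f a (b - t)) :=
    hc.integrable_of_hasCompactSupport hφc.smul_right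
  -- The mollification is a `C(X, ℝ)`-valued average of ridge functions with shifted bias.
  have key : ridge X 0 g a b = ∫ t, φ t • ridge X 0 f a (b - t) := by
    ext x
    have h1 := (ContinuousMap.evalCLM ℝ x).integral_comp_comm hi
    simp only [ContinuousMap.evalCLM_apply] at h1
    rw [← h1]
    simp only [ridge, ContinuousMap.coe_mk, hg, convolution_def, ContinuousMap.coe_smul,
      Pi.smul_apply, pow_zero, one_mul, ContinuousLinearMap.lsmul_apply, add_sub_assoc]
  rw [key, ← l.integral_comp_comm hi]
  simp [h]

end Functional

/-- Shallow networks with a continuous, nonpolynomial activation are dense in the space of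
continuous functions on a compact interval. -/
theorem topologicalClosure_span_ridge_eq_top {f : C(ℝ, ℝ)}
    (hf : ¬ ∃ p : ℝ[X], ∀ t, f t = p.eval t) (R : ℝ) :
    (Submodule.span ℝ (Set.range fun q : ℝ × ℝ =>
      ridge (Set.Icc (-R) R) 0 f q.1 q.2)).topologicalClosure = ⊤ := by
  set V := (Submodule.span ℝ (Set.range fun q : ℝ × ℝ =>
    ridge (Set.Icc (-R) R) 0 f q.1 q.2)).topologicalClosure with hV
  have hVc : IsClosed (V : Set C(Set.Icc (-R) R, ℝ)) := Submodule.isClosed_topologicalClosure _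
  have hmono : ∀ k, ridge (Set.Icc (-R) R) k 1 0 0 ∈ V := by
    intro k
    by_contra hk
    obtain ⟨l, hl, hlk⟩ := exists_strongDual_of_notMem hVc hk
    refine hf (exists_polynomial_of_convolution k f.continuous fun φ hφ hφc b => ?_)
    have hs : ContDiff ℝ (⊤ : ℕ∞) (φ ⋆[ContinuousLinearMap.lsmul ℝ ℝ, volume] f) :=
      hφc.contDiff_convolution_left _ hφ f.continuous.locallyIntegrable
    have h := apply_ridge_iteratedDeriv_eq_zero l (b := b) k 0 ⟨_, hs.continuous⟩ hs
      (fun a => apply_ridge_convolution_eq_zero l (f := f)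
        (fun a b => hl _ (Submodule.le_topologicalClosure _
          (Submodule.subset_span ⟨(a, b), rfl⟩))) hφ.continuous hφc (fun t => rfl) a b)
      ⟨_, hs.continuous_iteratedDeriv k (by exact_mod_cast le_top)⟩ (fun t => rfl) 0
    -- At `a = 0` the derivative is frozen at `b`, leaving a multiple of the monomial.
    have he : ridge (Set.Icc (-R) R) (0 + k)
        ⟨_, hs.continuous_iteratedDeriv k (by exact_mod_cast le_top)⟩ 0 b
        = iteratedDeriv k (φ ⋆[ContinuousLinearMap.lsmul ℝ ℝ, volume] f) b •
          ridge (Set.Icc (-R) R) k 1 0 0 := by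
      ext x
      simp [ridge, mul_comm]
    rw [he, map_smul, smul_eq_mul] at h
    exact (mul_eq_zero.1 h).resolve_right hlk
  have hpoly : ∀ p : C(Set.Icc (-R) R, ℝ), p ∈ polynomialFunctions (Set.Icc (-R) R) → p ∈ V := by
    rintro _ ⟨p, -, rfl⟩
    have : (Polynomial.toContinuousMapOnAlgHom (Set.Icc (-R) R)) p
        = ∑ i ∈ p.support, p.coeff i • ridge (Set.Icc (-R) R) i 1 0 0 := by
      ext x
      simp [ridge, Polynomial.eval_eq_sum, Polynomial.sum]
    change (Polynomial.toContinuousMapOnAlgHom (Set.Icc (-R) R)) p ∈ V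
    rw [this]
    exact V.sum_mem fun i _ => V.smul_mem _ (hmono i)
  rw [eq_top_iff]
  intro g _
  have hg : g ∈ (polynomialFunctions (Set.Icc (-R) R)).topologicalClosure := by
    rw [polynomialFunctions_closure_eq_top]; trivial
  exact closure_minimal hpoly hVc hg

end UniversalApprox

/-! ### Universal approximation on a compact space -/

namespace UniversalApprox

open Polynomial

/-- Approximation of continuous functions on `[-R, R]` by shallow networks. -/
theorem exists_shallow_approx {f : C(ℝ, ℝ)} (hf : ¬ ∃ p : ℝ[X], ∀ t, f t = p.eval t)
    (g : C(ℝ, ℝ)) (R : ℝ) {ε : ℝ} (hε : 0 < ε) :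
    ∃ (m : ℕ) (a b c : Fin m → ℝ), ∀ t, |t| ≤ R → |∑ i, c i * f (a i * t + b i) - g t| < ε := by
  have hg : g.restrict (Set.Icc (-R) R) ∈ (Submodule.span ℝ (Set.range fun q : ℝ × ℝ =>
      ridge (Set.Icc (-R) R) 0 f q.1 q.2)).topologicalClosure := by
    rw [topologicalClosure_span_ridge_eq_top hf R]; trivial
  obtain ⟨v, hv, hd⟩ := Metric.mem_closure_iff.1 hg ε hε
  obtain ⟨m, c, w, rfl⟩ := Submodule.mem_span_set'.1 hv
  choose q hq using fun i => (w i).2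
  refine ⟨m, fun i => (q i).1, fun i => (q i).2, c, fun t ht => ?_⟩
  have := (ContinuousMap.dist_apply_le_dist (⟨t, abs_le.1 ht⟩ : Set.Icc (-R) R)).trans_lt hd
  rw [dist_comm, Real.dist_eq] at this
  simpa [← hq, ridge, ContinuousMap.sum_apply] using this

variable {X : Type*} [TopologicalSpace X] [CompactSpace X]

/-- The functions `f ∘ (u + b)`, `u ∈ E` and `b` a constant, span a dense subspace of `C(X, ℝ)` if
`f` is continuous and not a polynomial and the subspace `E` separates points. -/
theorem topologicalClosure_span_comp_eq_top {f : C(ℝ, ℝ)}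
    (hf : ¬ ∃ p : ℝ[X], ∀ t, f t = p.eval t) (E : Submodule ℝ C(X, ℝ))
    (hE : ∀ x y, x ≠ y → ∃ u ∈ E, u x ≠ u y) :
    (Submodule.span ℝ {v : C(X, ℝ) | ∃ u ∈ E, ∃ b : ℝ, v = f.comp (u + .const X b)}
      ).topologicalClosure = ⊤ := by
  set W := (Submodule.span ℝ
    {v : C(X, ℝ) | ∃ u ∈ E, ∃ b : ℝ, v = f.comp (u + .const X b)}).topologicalClosure with hW
  let e : C(ℝ, ℝ) := ⟨Real.exp, Real.continuous_exp⟩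
  have hexp : ∀ u ∈ E, e.comp u ∈ W := by
    intro u hu
    refine Metric.mem_closure_iff.2 fun ε hε => ?_
    obtain ⟨m, a, b, c, h⟩ := exists_shallow_approx hf e ‖u‖ hε
    refine ⟨∑ i, c i • f.comp (a i • u + .const X (b i)), Submodule.sum_mem _ fun i _ =>
      Submodule.smul_mem _ _ (Submodule.subset_span ⟨_, E.smul_mem _ hu, _, rfl⟩), ?_⟩
    rw [ContinuousMap.dist_lt_iff hε]
    intro x
    rw [dist_comm, Real.dist_eq]
    simpa [ContinuousMap.sum_apply] using h (u x) (u.norm_coe_le_norm x)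
  -- Exponentials are closed under products, so the algebra they generate is just their linear span.
  let M : Submonoid C(X, ℝ) :=
    { carrier := {v | ∃ u ∈ E, v = e.comp u}
      one_mem' := ⟨0, E.zero_mem, by ext; simp [e]⟩
      mul_mem' := by
        rintro _ _ ⟨u, hu, rfl⟩ ⟨v, hv, rfl⟩
        exact ⟨u + v, E.add_mem hu hv, by ext; simp [e, Real.exp_add]⟩ }
  have hA : ∀ v ∈ Algebra.adjoin ℝ (M : Set C(X, ℝ)), v ∈ W := by
    intro v hv
    rw [← Subalgebra.mem_toSubmodule, Algebra.adjoin_eq_span, Submonoid.closure_eq] at hv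
    refine Submodule.span_le.2 ?_ hv
    rintro _ ⟨u, hu, rfl⟩
    exact hexp u hu
  have hsep : (Algebra.adjoin ℝ (M : Set C(X, ℝ))).SeparatesPoints := by
    intro x y hxy
    obtain ⟨u, hu, hne⟩ := hE x y hxy
    exact ⟨_, ⟨e.comp u, Algebra.subset_adjoin ⟨u, hu, rfl⟩, rfl⟩,
      fun h => hne (Real.exp_injective h)⟩
  rw [eq_top_iff]
  intro g _
  have hg := ContinuousMap.continuousMap_mem_subalgebra_closure_of_separatesPoints _ hsep g
  exact closure_minimal hA (Submodule.isClosed_topologicalClosure _) hg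

/-- Shallow networks fed with finitely many members of a family of continuous functions that
separates points are dense. -/
theorem exists_network_approx {f : C(ℝ, ℝ)} (hf : ¬ ∃ p : ℝ[X], ∀ t, f t = p.eval t)
    {ι : Type*} (Φ : ι → C(X, ℝ)) (hΦ : ∀ x y, x ≠ y → ∃ i, Φ i x ≠ Φ i y) (g : C(X, ℝ))
    {ε : ℝ} (hε : 0 < ε) :
    ∃ (T : Finset ι) (m : ℕ) (A : Fin m → ι → ℝ) (b c : Fin m → ℝ),
      ∀ x, |∑ j, c j * f (∑ i ∈ T, A j i * Φ i x + b j) - g x| < ε := by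
  classical
  have hg : g ∈ (Submodule.span ℝ {v : C(X, ℝ) | ∃ u ∈ Submodule.span ℝ (Set.range Φ),
      ∃ b : ℝ, v = f.comp (u + .const X b)}).topologicalClosure := by
    rw [topologicalClosure_span_comp_eq_top hf]
    · trivial
    · intro x y hxy
      obtain ⟨i, hi⟩ := hΦ x y hxy
      exact ⟨Φ i, Submodule.subset_span ⟨i, rfl⟩, hi⟩
  obtain ⟨v, hv, hd⟩ := Metric.mem_closure_iff.1 hg ε hε
  obtain ⟨m, c, w, rfl⟩ := Submodule.mem_span_set'.1 hv
  choose u hu b hb using fun j => (w j).2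
  choose l hl using fun j => Finsupp.mem_span_range_iff_exists_finsupp.1 (hu j)
  refine ⟨Finset.univ.biUnion fun j => (l j).support, m, fun j i => l j i, b, c, fun x => ?_⟩
  have hx := (ContinuousMap.dist_apply_le_dist x).trans_lt hd
  rw [dist_comm, Real.dist_eq] at hx
  have hsum : ∀ j, u j x = ∑ i ∈ Finset.univ.biUnion fun j => (l j).support, l j i * Φ i x := by
    intro j
    rw [← hl j, Finsupp.sum_of_support_subset _
      (Finset.subset_biUnion_of_mem (fun j => (l j).support) (Finset.mem_univ j)) _ (by simp)]
    simp [ContinuousMap.sum_apply]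
  simpa [hb, ContinuousMap.sum_apply, hsum] using hx

end UniversalApprox

namespace NeuralOp

open Filter Topology

/-! ### Truncation of integrable functions -/

/-- A sequence of continuous functions that decreases to `0` is small on compact sets. -/
theorem exists_forall_lt_of_antitone_tendsto {X : Type*} [TopologicalSpace X] {K : Set X}
    (hK : IsCompact K) {e : ℕ → X → ℝ} (hc : ∀ n, Continuous (e n))
    (ha : ∀ x, Antitone fun n => e n x) (h0 : ∀ x, Tendsto (fun n => e n x) atTop (𝓝 0))
    {δ : ℝ} (hδ : 0 < δ) : ∃ N, ∀ n ≥ N, ∀ x ∈ K, e n x < δ := by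
  -- Dini's argument: these open sets increase with `n` and cover `K`.
  obtain ⟨N, hN⟩ := hK.elim_directed_cover (fun n => {x | e n x < δ})
    (fun n => isOpen_lt (hc n) continuous_const)
    (fun x _ => Set.mem_iUnion.2 ((h0 x).eventually_lt_const hδ).exists)
    (directed_of_isDirected_le fun m n hmn x (hx : e m x < δ) => (ha x hmn).trans_lt hx)
  exact ⟨N, fun n hn x hx => (ha x hn).trans_lt (hN hx)⟩

/-- Truncation of a real number to `[-M, M]`, as a combination of ReLU functions. -/
def clip (M t : ℝ) : ℝ := max (t + M) 0 - max (t - M) 0 - M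

theorem clip_eq_max_min {M : ℝ} (hM : 0 ≤ M) (t : ℝ) : clip M t = max (-M) (min t M) := by
  unfold clip
  rcases le_total (-M) t with h1 | h1 <;> rcases le_total t M with h2 | h2
  · rw [max_eq_left (by linarith), max_eq_right (by linarith), min_eq_left h2, max_eq_right h1]
    ring
  · rw [max_eq_left (by linarith), max_eq_left (by linarith), min_eq_right h2,
      max_eq_right (by linarith)]
    ring
  · rw [max_eq_right (by linarith), max_eq_right (by linarith), min_eq_left h2, max_eq_left h1]
    ring
  · rw [max_eq_right (by linarith), max_eq_left (by linarith), min_eq_right h2,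
      max_eq_right (by linarith)]
    linarith

theorem abs_clip_le {M : ℝ} (hM : 0 ≤ M) (t : ℝ) : |clip M t| ≤ M := by
  rw [clip_eq_max_min hM, abs_le]
  exact ⟨le_max_left _ _, max_le (by linarith) (min_le_right _ _)⟩

theorem clip_zero {M : ℝ} (hM : 0 ≤ M) : clip M 0 = 0 := by
  rw [clip_eq_max_min hM, min_eq_left hM, max_eq_right (by linarith)]

theorem lipschitzWith_clip {M : ℝ} (hM : 0 ≤ M) : LipschitzWith 1 (clip M) := by
  rw [show clip M = fun t => max (-M) (min t M) from funext (clip_eq_max_min hM)]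
  exact (LipschitzWith.id.min_const M).const_max (-M)

theorem isShallowReLU_clip (M : ℝ) : IsShallowReLU (clip M) :=
  ⟨2, ![1, 1], ![M, -M], ![1, -1], -M, fun t => by
    simp [clip, Fin.sum_univ_two, sub_eq_add_neg]⟩

/-- This form makes the clipping error visibly antitone in `M` and zero once `|t| ≤ M`, as Dini's
argument requires. -/
theorem abs_sub_clip {M : ℝ} (hM : 0 ≤ M) (t : ℝ) : |t - clip M t| = max (|t| - M) 0 := by
  rw [clip_eq_max_min hM]
  rcases le_total (-M) t with h1 | h1 <;> rcases le_total t M with h2 | h2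
  · rw [min_eq_left h2, max_eq_right h1, sub_self, abs_zero,
      max_eq_right (sub_nonpos.2 (abs_le.2 ⟨h1, h2⟩))]
  · rw [min_eq_right h2, max_eq_right (by linarith), abs_of_nonneg (by linarith),
      abs_of_nonneg (by linarith), max_eq_left (by linarith)]
  · rw [min_eq_left h2, max_eq_left h1, abs_of_nonpos (by linarith),
      abs_of_nonpos (by linarith), max_eq_left (by linarith)]
    ring
  · have h3 : M = 0 := by linarith
    have h4 : t = 0 := by linarith
    simp [h3, h4]

section

variable {α : Type*} [MeasurableSpace α] {μ : Measure α}

theorem norm_L1_eq_integral_abs (f : Lp ℝ 1 μ) : ‖f‖ = ∫ x, |f x| ∂μ :=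
  L1.norm_eq_integral_norm f

theorem integrable_abs_sub_clip {M : ℝ} (hM : 0 ≤ M) (f : Lp ℝ 1 μ) :
    Integrable (fun x => |f x - clip M (f x)|) μ :=
  ((L1.integrable_coeFn f).sub (memLp_one_iff_integrable.1
    ((lipschitzWith_clip hM).comp_memLp (clip_zero hM) (Lp.memLp f)))).abs

/-- Truncation of values is uniformly close to the identity on compact subsets of `L¹`. -/
theorem exists_forall_integral_sub_clip_lt {K : Set (Lp ℝ 1 μ)} (hK : IsCompact K) {δ : ℝ}
    (hδ : 0 < δ) : ∃ M : ℝ, 0 ≤ M ∧ ∀ f ∈ K, ∫ x, |f x - clip M (f x)| ∂μ < δ := by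
  have hL : ∀ n : ℕ, LipschitzWith (1 + 1) fun t => t - clip n t := fun n =>
    LipschitzWith.id.sub (lipschitzWith_clip n.cast_nonneg)
  have hz : ∀ n : ℕ, (0 : ℝ) - clip n 0 = 0 := fun n => by
    rw [clip_zero n.cast_nonneg, sub_zero]
  have he : ∀ (n : ℕ) (f : Lp ℝ 1 μ), ∫ x, |f x - clip n (f x)| ∂μ = ‖(hL n).compLp (hz n) f‖ := by
    intro n f
    rw [norm_L1_eq_integral_abs]
    refine integral_congr_ae ?_
    filter_upwards [(hL n).coeFn_compLp (hz n) f] with x hx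
    rw [hx, Function.comp_apply]
  suffices h : ∃ N : ℕ, ∀ m ≥ N, ∀ f ∈ K, ∫ x, |f x - clip m (f x)| ∂μ < δ by
    obtain ⟨N, hN⟩ := h
    exact ⟨N, N.cast_nonneg, hN N le_rfl⟩
  refine exists_forall_lt_of_antitone_tendsto hK
    (e := fun n f => ∫ x, |f x - clip n (f x)| ∂μ) ?_ ?_ ?_ hδ
  · intro n
    simp only [he]
    exact (LipschitzWith.continuous_compLp (hL n) (hz n)).norm
  · intro f m n hmn
    refine integral_mono (integrable_abs_sub_clip n.cast_nonneg f)
      (integrable_abs_sub_clip m.cast_nonneg f) fun x => ?_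
    simp only [abs_sub_clip (Nat.cast_nonneg _)]
    have : (m : ℝ) ≤ n := by exact_mod_cast hmn
    gcongr
  · intro f
    have := tendsto_integral_of_dominated_convergence (μ := μ)
      (F := fun (n : ℕ) x => |f x - clip n (f x)|) (f := fun _ => 0) (fun x => |f x|)
      (fun n => (integrable_abs_sub_clip n.cast_nonneg f).aestronglyMeasurable)
      (L1.integrable_coeFn f).abs (fun n => ae_of_all _ fun x => ?_) (ae_of_all _ fun x => ?_)
    · simpa using this
    · rw [abs_sub_clip n.cast_nonneg, Real.norm_eq_abs, abs_of_nonneg (le_max_right _ _)]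
      exact max_le (by linarith [(Nat.cast_nonneg n : (0 : ℝ) ≤ n)]) (abs_nonneg _)
    · refine tendsto_const_nhds.congr' ?_
      filter_upwards [eventually_ge_atTop ⌈|f x|⌉₊] with n hn
      rw [abs_sub_clip n.cast_nonneg, max_eq_right]
      linarith [Nat.ceil_le.1 hn]

theorem integrable_mul_of_bounded {f ψ : α → ℝ} (hf : Integrable f μ)
    (hψ : AEStronglyMeasurable ψ μ) {C : ℝ} (hC : ∀ x, |ψ x| ≤ C) :
    Integrable (fun x => f x * ψ x) μ := by
  simpa only [mul_comm] using hf.bdd_mul (c := C) hψ (ae_of_all _ hC)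

/-- Pairing with a bounded function is continuous on `L¹`. -/
theorem continuous_integral_mul {ψ : α → ℝ} (hψ : AEStronglyMeasurable ψ μ) {C : ℝ}
    (hC : ∀ x, |ψ x| ≤ C) : Continuous fun f : Lp ℝ 1 μ => ∫ x, f x * ψ x ∂μ := by
  -- `α` may be empty, so the sign of `C` is known only in the presence of a point.
  have hC0 : ∀ x : α, 0 ≤ C := fun x => (abs_nonneg _).trans (hC x)
  have hi := fun f : Lp ℝ 1 μ => integrable_mul_of_bounded (L1.integrable_coeFn f) hψ hC
  refine (LipschitzWith.of_dist_le_mul (K := C.toNNReal) fun f g => ?_).continuous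
  rw [Real.dist_eq, ← integral_sub (hi f) (hi g), dist_eq_norm, norm_L1_eq_integral_abs,
    ← integral_const_mul]
  refine (abs_integral_le_integral_abs).trans (integral_mono_ae ((hi f).sub (hi g)).abs
    ((L1.integrable_coeFn (f - g)).abs.const_mul _) ?_)
  filter_upwards [Lp.coeFn_sub f g] with x hx
  rw [hx, Pi.sub_apply, ← sub_mul, abs_mul, mul_comm, Real.coe_toNNReal C (hC0 x)]
  exact mul_le_mul_of_nonneg_right (hC x) (abs_nonneg _)

end

theorem iUnion_cube (n : ℕ) : ⋃ N : ℕ, cube n N = Set.univ := by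
  refine Set.eq_univ_of_forall fun x => Set.mem_iUnion.2 ⟨⌊‖x‖⌋₊ + 1, fun i _ => ?_⟩
  rw [Set.mem_Ioo, ← abs_lt]
  push_cast
  exact (norm_le_pi_norm x i).trans_lt (Nat.lt_floor_add_one _)

theorem cube_mono (n : ℕ) {r s : ℝ} (h : r ≤ s) : cube n r ⊆ cube n s :=
  Set.pi_mono fun _ _ => Set.Ioo_subset_Ioo (neg_le_neg h) h

/-- The mass outside of large cubes is uniformly small on compact subsets of `L¹`. -/
theorem exists_forall_integral_compl_cube_lt {n : ℕ} {K : Set (L1 n)} (hK : IsCompact K) {δ : ℝ}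
    (hδ : 0 < δ) : ∃ R : ℝ, 0 < R ∧ ∀ f ∈ K, ∫ x in (cube n R)ᶜ, |f x| < δ := by
  have he : ∀ (N : ℕ) (f : L1 n), ∫ x in (cube n N)ᶜ, |f x| = ‖restriction (cube n N)ᶜ f‖ := by
    intro N f
    rw [norm_L1_eq_integral_abs]
    refine integral_congr_ae ?_
    filter_upwards [LpToLpRestrictCLM_coeFn ℝ (cube n N)ᶜ f] with x hx
    rw [restriction, hx]
  suffices h : ∃ N : ℕ, ∀ m ≥ N, ∀ f ∈ K, ∫ x in (cube n m)ᶜ, |f x| < δ by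
    obtain ⟨N, hN⟩ := h
    -- `N` may be `0`, but the radius must be positive.
    exact ⟨(N + 1 : ℕ), by positivity, hN (N + 1) N.le_succ⟩
  refine exists_forall_lt_of_antitone_tendsto hK
    (e := fun N f => ∫ x in (cube n N)ᶜ, |f x|) ?_ ?_ ?_ hδ
  · intro N
    simp only [he]
    exact (LpToLpRestrictCLM (Fin n → ℝ) ℝ ℝ volume 1 (cube n N)ᶜ).continuous.norm
  · intro f m n hmn
    exact setIntegral_mono_set (L1.integrable_coeFn f).abs.integrableOn
      (ae_of_all _ fun _ => abs_nonneg _)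
      (LE.le.eventuallyLE (Set.compl_subset_compl.2 (cube_mono _ (by exact_mod_cast hmn))))
  · intro f
    have := tendsto_setIntegral_of_antitone (μ := volume) (f := fun x => |f x|)
      (s := fun N : ℕ => (cube n N)ᶜ) (fun N => (measurableSet_cube n N).compl)
      (fun i j hij => Set.compl_subset_compl.2 (cube_mono _ (by exact_mod_cast hij)))
      ⟨0, (L1.integrable_coeFn f).abs.integrableOn⟩
    rwa [← Set.compl_iUnion, iUnion_cube, Set.compl_univ, setIntegral_empty] at this

/-- The distance to a zero extension splits into the parts inside and outside of the domain. -/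
theorem norm_sub_zeroExtension {n : ℕ} {Ω : Set (Fin n → ℝ)} (hΩ : MeasurableSet Ω) (f : L1 n)
    (G : L1On Ω) : ‖f - zeroExtension hΩ G‖ = ‖restriction Ω f - G‖ + ∫ x in Ωᶜ, |f x| := by
  have hz : zeroExtension hΩ G =ᵐ[volume] Ω.indicator G := MemLp.coeFn_toLp _
  have hs := Lp.coeFn_sub f (zeroExtension hΩ G)
  rw [norm_L1_eq_integral_abs, norm_L1_eq_integral_abs,
    ← integral_add_compl hΩ (L1.integrable_coeFn (f - zeroExtension hΩ G)).abs]
  congr 1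
  · refine integral_congr_ae ?_
    filter_upwards [ae_restrict_of_ae hz, ae_restrict_of_ae hs, ae_restrict_mem hΩ,
      LpToLpRestrictCLM_coeFn ℝ Ω f, Lp.coeFn_sub (restriction Ω f) G] with x h1 h2 h3 h4 h5
    rw [h2, h5, Pi.sub_apply, Pi.sub_apply, h1, restriction, h4, Set.indicator_of_mem h3]
  · refine integral_congr_ae ?_
    filter_upwards [ae_restrict_of_ae hz, ae_restrict_of_ae hs, ae_restrict_mem hΩ.compl]
      with x h1 h2 h3
    rw [h2, Pi.sub_apply, h1, Set.indicator_of_notMem h3, sub_zero]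

/-- A continuous map from a compact space to `L¹` is approximated by a continuous map to the
bounded continuous functions. -/
theorem exists_continuous_approx {X α : Type*} [TopologicalSpace X] [CompactSpace X] [T2Space X]
    [TopologicalSpace α] [NormalSpace α] [MeasurableSpace α] [BorelSpace α] {μ : Measure α}
    [μ.WeaklyRegular] [IsFiniteMeasure μ] (G : C(X, Lp ℝ 1 μ)) {δ : ℝ} (hδ : 0 < δ) :
    ∃ g : C(X, BoundedContinuousFunction α ℝ),
      ∀ x, ‖G x - BoundedContinuousFunction.toLp 1 μ ℝ (g x)‖ < δ := by
  -- Convexity of the admissible sets lets locally constant choices be glued by a partition of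
  -- unity.
  have hconv : ∀ x, Convex ℝ ((BoundedContinuousFunction.toLp (E := ℝ) 1 μ ℝ) ⁻¹'
      Metric.ball (G x) δ) := fun x =>
    (convex_ball (G x) δ).linear_preimage (BoundedContinuousFunction.toLp 1 μ ℝ).toLinearMap
  obtain ⟨g, hg⟩ := exists_continuous_forall_mem_convex_of_local_const hconv (fun x => by
    obtain ⟨h, hh⟩ := (BoundedContinuousFunction.toLp_denseRange (E := ℝ) μ ℝ
      ENNReal.one_ne_top).exists_dist_lt (G x) hδ
    refine ⟨h, ?_⟩
    have : Continuous fun y => dist (G y) (BoundedContinuousFunction.toLp 1 μ ℝ h) := by fun_prop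
    filter_upwards [(this.tendsto x).eventually_lt_const hh] with y hy
    rwa [Set.mem_preimage, Metric.mem_ball, dist_comm])
  refine ⟨g, fun x => ?_⟩
  have := hg x
  rwa [Set.mem_preimage, Metric.mem_ball, dist_comm, dist_eq_norm] at this

end NeuralOp

namespace NeuralOp

open Filter Topology

/-! ### Networks and hidden layers in coordinates -/

theorem isNeuralNetwork_sum (τ : ℝ → ℝ) {p m : ℕ} (A : Fin m → Fin p → ℝ) (b c : Fin m → ℝ) :
    IsNeuralNetwork τ fun (x : Fin p → ℝ) (_ : Fin 1) =>
      ∑ j, c j * τ (∑ i, A j i * x i + b j) := by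
  have h := IsNeuralNetwork.shallow (τ := τ) (Matrix.of A) b (Matrix.of fun (_ : Fin 1) j => c j) 0
  convert h using 1
  ext x i
  simp [denseLayer, Matrix.mulVec, dotProduct]

/-- A shallow network `ℝ → ℝ`. -/
def scalarNet (τ : ℝ → ℝ) {m : ℕ} (a b c : Fin m → ℝ) (t : ℝ) : ℝ :=
  ∑ j, c j * τ (a j * t + b j)

/-- A shallow network `ℝᵖ × ℝᵏ → ℝ`. -/
def pairNet (τ : ℝ → ℝ) {p k m : ℕ} (A : Fin m → Fin p → ℝ) (B : Fin m → Fin k → ℝ)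
    (b c : Fin m → ℝ) (y : Fin p → ℝ) (w : Fin k → ℝ) : ℝ :=
  ∑ j, c j * τ (∑ i, A j i * y i + ∑ l, B j l * w l + b j)

/-- Zero weights on the coordinates of `x` make the lifting independent of position. -/
theorem exists_isNeuralNetwork_scalarNet (τ : ℝ → ℝ) (n : ℕ) {m : ℕ} (a b c : Fin m → ℝ) :
    ∃ N : (Fin (n + 1) → ℝ) → (Fin 1 → ℝ), IsNeuralNetwork τ N ∧
      ∀ x u i, N (Fin.append x u) i = scalarNet τ a b c (u 0) :=
  ⟨_, isNeuralNetwork_sum τ (fun j => Fin.append (0 : Fin n → ℝ) fun _ : Fin 1 => a j) b c,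
    fun x u i => by simp [scalarNet, Fin.sum_univ_add]⟩

theorem exists_isNeuralNetwork_pairNet (τ : ℝ → ℝ) {p k m : ℕ} (A : Fin m → Fin p → ℝ)
    (B : Fin m → Fin k → ℝ) (b c : Fin m → ℝ) :
    ∃ Q : (Fin (p + k) → ℝ) → (Fin 1 → ℝ), IsNeuralNetwork τ Q ∧
      ∀ y w i, Q (Fin.append y w) i = pairNet τ A B b c y w :=
  ⟨_, isNeuralNetwork_sum τ (fun j => Fin.append (A j) (B j)) b c,
    fun x u i => by simp [pairNet, Fin.sum_univ_add]⟩

/-- The hidden layer with constant decoding functions that computes `σ (a i * ⟨f, ψ i⟩ + b i)`. -/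
theorem isHiddenLayer_pairing (σ : ℝ → ℝ) {n n' k : ℕ} (Ω : Set (Fin n → ℝ))
    (Ω' : Set (Fin n' → ℝ)) {ψ : Fin k → (Fin n → ℝ) → ℝ} (hψ : ∀ l, Continuous (ψ l))
    (hb : ∀ l, ∃ C, ∀ x, |ψ l x| ≤ C) (a b : Fin k → ℝ) :
    IsHiddenLayer σ Ω Ω' fun (f : Field n 1) (_ : Fin n' → ℝ) (l : Fin k) =>
      σ (a l * (∫ x in Ω, f x 0 * ψ l x) + b l) := by
  -- The constant decoding function `Pi.single l (a l)` sends the `l`-th pairing, scaled by `a l`,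
  -- to component `l` alone.
  refine ⟨_, b, k, fun _ => 1, fun l x _ => ψ l x, fun l _ => Pi.single l (a l),
    IsLocalTerm.zero Ω', fun l => ⟨(continuous_pi fun _ => hψ l).continuousOn, ?_⟩,
    fun l => ⟨continuousOn_const, ‖(Pi.single l (a l) : Fin k → ℝ)‖, fun _ _ => le_rfl⟩, ?_⟩
  · obtain ⟨C, hC⟩ := hb l
    exact ⟨C, fun x _ => (pi_norm_le_iff_of_nonneg ((abs_nonneg _).trans (hC x))).2 fun _ => hC x⟩
  · funext f y i
    simp only [nonlocalTerm, Pi.add_apply, Finset.sum_apply, Pi.smul_apply, Pi.zero_apply,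
      Matrix.one_mulVec, smul_eq_mul, dotProduct, Fin.sum_univ_one, Fin.isValue]
    rw [Finset.sum_eq_single i (fun l _ hl => by simp [hl.symm]) (by simp)]
    rw [Pi.single_eq_same]
    congr 1
    ring

theorem cube_subset_Icc (n : ℕ) (R : ℝ) :
    cube n R ⊆ Set.Icc (fun _ => -R) (fun _ => R) := fun _ hx =>
  ⟨fun i => (hx i trivial).1.le, fun i => (hx i trivial).2.le⟩

instance isFiniteMeasure_restrict_cube (n : ℕ) (R : ℝ) :
    IsFiniteMeasure ((volume : Measure (Fin n → ℝ)).restrict (cube n R)) :=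
  isFiniteMeasure_restrict.2
    ((measure_mono (cube_subset_Icc n R)).trans_lt isCompact_Icc.measure_lt_top).ne

theorem continuous_pairNet {τ : ℝ → ℝ} (hτ : Continuous τ) {p k m : ℕ} (A : Fin m → Fin p → ℝ)
    (B : Fin m → Fin k → ℝ) (b c : Fin m → ℝ) (w : Fin k → ℝ) :
    Continuous fun y => pairNet τ A B b c y w := by
  unfold pairNet
  fun_prop

/-- The neural operator `f ↦ Q (y, σ (a l * ⟨N ∘ f, ψ l⟩ + b l))` for shallow networks `N`, `Q`. -/
theorem exists_isNeuralOperator (σ : ℝ → ℝ) {τ : ℝ → ℝ} (hτ : Continuous τ) {n n' k m m' : ℕ}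
    (Ω : Set (Fin n → ℝ)) (R : ℝ) {ψ : Fin k → (Fin n → ℝ) → ℝ} (hψ : ∀ l, Continuous (ψ l))
    (hb : ∀ l, ∃ C, ∀ x, |ψ l x| ≤ C) (a₁ b₁ c₁ : Fin m → ℝ) (a₂ b₂ : Fin k → ℝ)
    (A : Fin m' → Fin n' → ℝ) (B : Fin m' → Fin k → ℝ) (b₃ c₃ : Fin m' → ℝ) :
    ∃ Ψ : L1On Ω → L1On (cube n' R), IsNeuralOperator σ τ Ω (cube n' R) Ψ ∧
      ∀ f : L1On Ω, ∀ᵐ y ∂(volume.restrict (cube n' R)), Ψ f y = pairNet τ A B b₃ c₃ y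
        (fun l => σ (a₂ l * (∫ x in Ω, scalarNet τ a₁ b₁ c₁ (f x) * ψ l x) + b₂ l)) := by
  obtain ⟨N, hN, hN'⟩ := exists_isNeuralNetwork_scalarNet τ n a₁ b₁ c₁
  obtain ⟨Q, hQ, hQ'⟩ := exists_isNeuralNetwork_pairNet τ A B b₃ c₃
  have hmem : ∀ f : L1On Ω, MemLp (fun y => pairNet τ A B b₃ c₃ y
      (fun l => σ (a₂ l * (∫ x in Ω, scalarNet τ a₁ b₁ c₁ (f x) * ψ l x) + b₂ l))) 1
      (volume.restrict (cube n' R)) := fun f =>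
    memLp_one_iff_integrable.2 (IntegrableOn.mono_set
      ((continuous_pairNet hτ A B b₃ c₃ _).continuousOn.integrableOn_compact isCompact_Icc)
      (cube_subset_Icc n' R))
  refine ⟨fun f => (hmem f).toLp _, ⟨1, k, N, _, Q, hN,
    IsHiddenStack.last (isHiddenLayer_pairing σ Ω (cube n' R) hψ hb a₂ b₂), hQ, fun f => ?_⟩,
    fun f => (hmem f).coeFn_toLp⟩
  filter_upwards [(hmem f).coeFn_toLp] with y hy
  rw [hy, pointwiseLayer, hQ']
  simp only [pointwiseLayer, hN']

/-! ### The approximation argument -/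

/-- Approximation of a continuous function on `K × [-R, R]ᵖ`, `K` a compact subset of `L¹`, by
a network fed with the coordinates and with values of `σ` at pairings with test functions. -/
theorem exists_pairNet_approx {σ τ : ℝ → ℝ} (hσ : Continuous σ) (hσ' : ∃ s t, σ s ≠ σ t)
    (hτ : Continuous τ) (hτ' : ¬ ∃ q : Polynomial ℝ, ∀ t, τ t = q.eval t) {n p : ℕ}
    {K : Set (L1 n)} (hK : IsCompact K) (R : ℝ) (g : C(K, BoundedContinuousFunction (Fin p → ℝ) ℝ))
    {η : ℝ} (hη : 0 < η) :
    ∃ (k m : ℕ) (ψ : Fin k → (Fin n → ℝ) → ℝ) (a₂ b₂ : Fin k → ℝ) (A : Fin m → Fin p → ℝ)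
      (B : Fin m → Fin k → ℝ) (b₃ c₃ : Fin m → ℝ),
      (∀ l, Continuous (ψ l) ∧ HasCompactSupport (ψ l)) ∧
      ∀ (ρ : K), ∀ y ∈ cube p R,
        |pairNet τ A B b₃ c₃ y (fun l => σ (a₂ l * (∫ x, ρ.1 x * ψ l x) + b₂ l)) - g ρ y| < η := by
  classical
  have : CompactSpace K := isCompact_iff_compactSpace.1 hK
  -- The closed box replaces the open cube to make `K × Y` compact.
  let Y : Set (Fin p → ℝ) := Set.Icc (fun _ => -R) (fun _ => R)
  let P : Type := {ψ : (Fin n → ℝ) → ℝ // Continuous ψ ∧ HasCompactSupport ψ} × ℝ × ℝ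
  let z : {ψ : (Fin n → ℝ) → ℝ // Continuous ψ ∧ HasCompactSupport ψ} → L1 n → ℝ :=
    fun ψ f => ∫ x, f x * ψ.1 x
  have hz : ∀ ψ, Continuous (z ψ) := by
    intro ψ
    obtain ⟨C, hC⟩ := ψ.2.2.exists_bound_of_continuous ψ.2.1
    exact continuous_integral_mul ψ.2.1.aestronglyMeasurable hC
  let Φ : Fin p ⊕ P → C(K × Y, ℝ) := Sum.elim (fun i => ⟨fun x => x.2.1 i,
    (continuous_apply i).comp (continuous_subtype_val.comp continuous_snd)⟩)
    (fun q => ⟨fun x => σ (q.2.1 * z q.1 x.1.1 + q.2.2), by have := hz q.1; fun_prop⟩)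
  have hsep : ∀ x y, x ≠ y → ∃ i, Φ i x ≠ Φ i y := by
    rintro ⟨ρ, y⟩ ⟨ρ', y'⟩ hne
    by_cases hy : y = y'
    · have hρ : ρ ≠ ρ' := fun h => hne (by rw [h, hy])
      obtain ⟨ψ, hψ⟩ : ∃ ψ, z ψ ρ.1 ≠ z ψ ρ'.1 := by
        by_contra! hall
        refine hρ (Subtype.ext (Lp.ext ?_))
        -- Integrals against smooth compactly supported functions determine a locally integrable
        -- function almost everywhere.
        refine ae_eq_of_integral_contDiff_smul_eq (L1.integrable_coeFn ρ.1).locallyIntegrable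
          (L1.integrable_coeFn ρ'.1).locallyIntegrable fun h hh hc => ?_
        have := hall ⟨h, hh.continuous, hc⟩
        simpa only [z, smul_eq_mul, mul_comm] using this
      obtain ⟨s, t, hst⟩ := hσ'
      have hd : z ψ ρ.1 - z ψ ρ'.1 ≠ 0 := sub_ne_zero.2 hψ
      -- Weight and bias of the affine map taking the two pairings to `s` and `t`, where `σ`
      -- differs.
      refine ⟨Sum.inr (ψ, (s - t) / (z ψ ρ.1 - z ψ ρ'.1),
        s - (s - t) / (z ψ ρ.1 - z ψ ρ'.1) * z ψ ρ.1), ?_⟩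
      have e1 : (s - t) / (z ψ ρ.1 - z ψ ρ'.1) * z ψ ρ.1 +
          (s - (s - t) / (z ψ ρ.1 - z ψ ρ'.1) * z ψ ρ.1) = s := by ring
      have e2 : (s - t) / (z ψ ρ.1 - z ψ ρ'.1) * z ψ ρ'.1 +
          (s - (s - t) / (z ψ ρ.1 - z ψ ρ'.1) * z ψ ρ.1) = t := by
        field_simp
        ring
      simpa only [Φ, Sum.elim_inr, ContinuousMap.coe_mk, e1, e2] using hst
    · obtain ⟨i, hi⟩ := Function.ne_iff.1 (fun h => hy (Subtype.ext h))
      exact ⟨Sum.inl i, hi⟩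
  let G : C(K × Y, ℝ) := ⟨fun x => g x.1 x.2.1, 
    (g.continuous.comp continuous_fst).eval (continuous_subtype_val.comp continuous_snd)⟩
  obtain ⟨T, m, A, b, c, h⟩ :=
    UniversalApprox.exists_network_approx (f := ⟨τ, hτ⟩) hτ' Φ hsep G hη
  let e := T.toRight.equivFin
  refine ⟨T.toRight.card, m, fun l => (e.symm l).1.1.1, fun l => (e.symm l).1.2.1,
    fun l => (e.symm l).1.2.2, fun j i => if Sum.inl i ∈ T then A j (Sum.inl i) else 0,
    fun j l => A j (Sum.inr (e.symm l).1), b, c, fun l => (e.symm l).1.1.2, fun ρ y hy => ?_⟩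
  have hx := h (ρ, ⟨y, cube_subset_Icc p R hy⟩)
  have hsum : ∀ j, ∑ i ∈ T, A j i * Φ i (ρ, ⟨y, cube_subset_Icc p R hy⟩)
      = ∑ i, (if Sum.inl i ∈ T then A j (Sum.inl i) else 0) * y i +
        ∑ l, A j (Sum.inr (e.symm l).1) *
          σ ((e.symm l).1.2.1 * (∫ x, ρ.1 x * (e.symm l).1.1.1 x) + (e.symm l).1.2.2) := by
    intro j
    have hT := Finset.sum_disjSum T.toLeft T.toRight
      fun i => A j i * Φ i (ρ, ⟨y, cube_subset_Icc p R hy⟩)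
    rw [T.toLeft_disjSum_toRight] at hT
    rw [hT]
    congr 1
    · simp only [ite_mul, zero_mul, ← Finset.mem_toLeft]
      rw [Finset.sum_ite_mem, Finset.univ_inter]
      simp [Φ]
    · rw [← Finset.sum_coe_sort, ← e.symm.sum_comp]
      rfl
  simp only [hsum] at hx
  exact hx

/-- Composition of `pairNet` with `σ` is Lipschitz in the pairings. -/
theorem exists_pairNet_lipschitz {σ τ : ℝ → ℝ} {C D : NNReal} (hσ : LipschitzWith C σ)
    (hτ : LipschitzWith D τ) {k p m : ℕ} (a₂ b₂ : Fin k → ℝ) (A : Fin m → Fin p → ℝ)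
    (B : Fin m → Fin k → ℝ) (b₃ c₃ : Fin m → ℝ) :
    ∃ E : ℝ, 0 ≤ E ∧ ∀ (y : Fin p → ℝ) (z z' : Fin k → ℝ) (δ : ℝ), (∀ l, |z l - z' l| ≤ δ) →
      |pairNet τ A B b₃ c₃ y (fun l => σ (a₂ l * z l + b₂ l)) -
        pairNet τ A B b₃ c₃ y (fun l => σ (a₂ l * z' l + b₂ l))| ≤ E * δ := by
  refine ⟨∑ j, |c₃ j| * (D * ∑ l, |B j l| * (C * |a₂ l|)), by positivity,
    fun y z z' δ h => ?_⟩
  have hl : ∀ l, |σ (a₂ l * z l + b₂ l) - σ (a₂ l * z' l + b₂ l)| ≤ C * |a₂ l| * δ := by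
    intro l
    have := hσ.dist_le_mul (a₂ l * z l + b₂ l) (a₂ l * z' l + b₂ l)
    rw [Real.dist_eq, Real.dist_eq, add_sub_add_right_eq_sub, ← mul_sub, abs_mul,
      ← mul_assoc] at this
    exact this.trans (mul_le_mul_of_nonneg_left (h l) (by positivity))
  unfold pairNet
  rw [← Finset.sum_sub_distrib, Finset.sum_mul]
  refine (Finset.abs_sum_le_sum_abs _ _).trans (Finset.sum_le_sum fun j _ => ?_)
  rw [← mul_sub, abs_mul, mul_assoc]
  refine mul_le_mul_of_nonneg_left ?_ (abs_nonneg _)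
  rw [← Real.dist_eq]
  refine (hτ.dist_le_mul _ _).trans ?_
  rw [mul_assoc]
  refine mul_le_mul_of_nonneg_left ?_ D.coe_nonneg
  rw [Real.dist_eq, add_sub_add_right_eq_sub, add_sub_add_left_eq_sub, ← Finset.sum_sub_distrib,
    Finset.sum_mul]
  refine (Finset.abs_sum_le_sum_abs _ _).trans (Finset.sum_le_sum fun l _ => ?_)
  rw [← mul_sub, abs_mul, mul_assoc]
  exact mul_le_mul_of_nonneg_left (hl l) (abs_nonneg _)

/-- Pairings with finitely many test functions are approximated, uniformly on a compact subset of
`L¹`, by pairings on a cube after truncation of the values and application of a network. -/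
theorem exists_scalarNet_pairing_approx {τ : ℝ → ℝ} (hτ : Continuous τ)
    (hτ' : ¬ ∃ q : Polynomial ℝ, ∀ t, τ t = q.eval t) {n k : ℕ} {K : Set (L1 n)} (hK : IsCompact K)
    {ψ : Fin k → (Fin n → ℝ) → ℝ} (hψ : ∀ l, Continuous (ψ l) ∧ HasCompactSupport (ψ l))
    {δ : ℝ} (hδ : 0 < δ) :
    ∃ (R M : ℝ) (m : ℕ) (a b c : Fin m → ℝ), 0 < R ∧ 0 ≤ M ∧ ∀ f ∈ K, ∀ l,
      |(∫ x, f x * ψ l x) - ∫ x in cube n R, scalarNet τ a b c (clip M (f x)) * ψ l x| ≤ δ := by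
  choose C hC using fun l => (hψ l).2.exists_bound_of_continuous (hψ l).1
  set C₀ : ℝ := ∑ l, |C l| with hC₀
  have hC₀' : 0 ≤ C₀ := Finset.sum_nonneg fun _ _ => abs_nonneg _
  have hb : ∀ l x, |ψ l x| ≤ C₀ := fun l x => (hC l x).trans ((le_abs_self _).trans
    (Finset.single_le_sum (f := fun l => |C l|) (fun _ _ => abs_nonneg _) (Finset.mem_univ l)))
  obtain ⟨R, hR, hsupp⟩ : ∃ R : ℝ, 0 < R ∧ ∀ l, ∀ x ∉ cube n R, ψ l x = 0 := by
    have hc : IsCompact (⋃ l, tsupport (ψ l)) := isCompact_iUnion fun l => (hψ l).2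
    obtain ⟨r, hr⟩ := hc.isBounded.exists_norm_le
    refine ⟨max r 0 + 1, by positivity, fun l x hx => ?_⟩
    by_contra hne
    refine hx fun i _ => ?_
    rw [Set.mem_Ioo, ← abs_lt]
    have h1 := hr x (Set.mem_iUnion.2 ⟨l, subset_tsupport _ hne⟩)
    have h2 := norm_le_pi_norm x i
    rw [Real.norm_eq_abs] at h2
    linarith [le_max_left r 0]
  set V : ℝ := volume.real (cube n R) with hV
  have hV0 : 0 ≤ V := measureReal_nonneg
  -- Clipping and the network each get an L¹ error of `δ / (2 * (C₀ + 1))` on the cube; pairing with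
  -- `ψ l` costs a factor `C₀`. The added ones avoid division by zero.
  obtain ⟨M, hM, hclip⟩ := exists_forall_integral_sub_clip_lt hK
    (show 0 < δ / (2 * (C₀ + 1)) by positivity)
  obtain ⟨m, a, b, c, hN⟩ := UniversalApprox.exists_shallow_approx (f := ⟨τ, hτ⟩) hτ'
    (ContinuousMap.id ℝ) M (show 0 < δ / (2 * (C₀ + 1) * (V + 1)) by positivity)
  set θ := δ / (2 * (C₀ + 1) * (V + 1)) with hθ
  have hN' : ∀ t, |scalarNet τ a b c (clip M t) - clip M t| < θ := fun t =>
    hN _ (abs_clip_le hM t)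
  refine ⟨R, M, m, a, b, c, hR, hM, fun f hf l => ?_⟩
  have hcont : Continuous fun t => scalarNet τ a b c (clip M t) := by
    have := (lipschitzWith_clip hM).continuous
    unfold scalarNet
    fun_prop
  have hi1 : Integrable (fun x => f x * ψ l x) (volume.restrict (cube n R)) :=
    integrable_mul_of_bounded (L1.integrable_coeFn f).restrict (hψ l).1.aestronglyMeasurable (hb l)
  have hi2 : Integrable (fun x => scalarNet τ a b c (clip M (f x)) * ψ l x)
      (volume.restrict (cube n R)) := by
    refine integrable_mul_of_bounded (Integrable.of_bound (C := θ + M)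
      (hcont.comp_aestronglyMeasurable (Lp.aestronglyMeasurable f).restrict)
      (ae_of_all _ fun x => ?_)) (hψ l).1.aestronglyMeasurable (hb l)
    rw [Real.norm_eq_abs]
    have := abs_add_le (scalarNet τ a b c (clip M (f x)) - clip M (f x)) (clip M (f x))
    rw [sub_add_cancel] at this
    linarith [hN' (f x), abs_clip_le hM (f x)]
  have hi3 := integrable_abs_sub_clip hM f
  rw [← setIntegral_eq_integral_of_forall_compl_eq_zero (s := cube n R)
    (fun x hx => by rw [hsupp l x hx, mul_zero]), ← integral_sub hi1 hi2]
  have hbound : ∀ x, ‖f x * ψ l x - scalarNet τ a b c (clip M (f x)) * ψ l x‖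
      ≤ (|f x - clip M (f x)| + θ) * C₀ := by
    intro x
    rw [← sub_mul, Real.norm_eq_abs, abs_mul]
    refine mul_le_mul ?_ (hb l x) (abs_nonneg _) (by positivity)
    refine (abs_sub_le _ (clip M (f x)) _).trans (add_le_add_right ?_ _)
    rw [abs_sub_comm]
    exact (hN' _).le
  have h1 := norm_integral_le_of_norm_le (μ := volume.restrict (cube n R))
    ((hi3.restrict.add (integrable_const θ)).mul_const C₀) (ae_of_all _ hbound)
  refine h1.trans ?_
  simp only [Pi.add_apply]
  rw [integral_mul_const, integral_add hi3.restrict (integrable_const θ), integral_const,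
    measureReal_restrict_apply_univ, smul_eq_mul]
  have h2 : ∫ x in cube n R, |f x - clip M (f x)| ≤ δ / (2 * (C₀ + 1)) :=
    (setIntegral_le_integral hi3 (ae_of_all _ fun _ => abs_nonneg _)).trans (hclip f hf).le
  have h3 : V * θ ≤ δ / (2 * (C₀ + 1)) := by
    rw [hθ, ← div_div, mul_div_assoc', div_le_iff₀ (by positivity), mul_comm]
    exact mul_le_mul_of_nonneg_left (by linarith) (by positivity)
  calc ((∫ x in cube n R, |f x - clip M (f x)|) + V * θ) * C₀
      ≤ (δ / (2 * (C₀ + 1)) + δ / (2 * (C₀ + 1))) * (C₀ + 1) :=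
        mul_le_mul (add_le_add h2 h3) (by linarith) hC₀' (by positivity)
    _ = δ := by field_simp; ring

end NeuralOp

/-! ### The universal approximation theorem -/

namespace NeuralOp

theorem IsActivation.exists_ne {σ : ℝ → ℝ} (hσ : IsActivation σ) : ∃ s t, σ s ≠ σ t := by
  by_contra! h
  exact hσ.2 ⟨Polynomial.C (σ 0), fun t => by rw [Polynomial.eval_C, h t 0]⟩

end NeuralOp

theorem mainTheorem3 (σ τ : ℝ → ℝ) (hσ : NeuralOp.IsActivation σ) (hτ : NeuralOp.IsActivation τ)
    (d d' : ℕ) (F : NeuralOp.L1 d → NeuralOp.L1 d') (hF : Continuous F)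
    (K : Set (NeuralOp.L1 d)) (hK : IsCompact K) (ε : ℝ) (hε : 0 < ε) :
    ∃ R R' : ℝ, 0 < R ∧ 0 < R' ∧ ∃ Ψ : NeuralOp.L1 d → NeuralOp.L1 d',
      NeuralOp.IsFullNeuralOperator σ τ (NeuralOp.cube d R) (NeuralOp.measurableSet_cube d' R') Ψ ∧
      ∀ ρ ∈ K, ‖F ρ - Ψ ρ‖ ≤ ε := by
  open NeuralOp in
  obtain ⟨C, hC⟩ := hσ.1
  obtain ⟨D, hD⟩ := hτ.1
  have : CompactSpace K := isCompact_iff_compactSpace.1 hK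
  obtain ⟨R', hR', htail⟩ := exists_forall_integral_compl_cube_lt (hK.image hF)
    (show 0 < ε / 4 by positivity)
  set Ω' := cube d' R' with hΩ'
  set V : ℝ := volume.real Ω' with hV
  have hV0 : 0 ≤ V := measureReal_nonneg
  let G : C(K, L1On Ω') := ⟨fun ρ => restriction Ω' (F ρ),
    (LpToLpRestrictCLM (Fin d' → ℝ) ℝ ℝ volume 1 Ω').continuous.comp
      (hF.comp continuous_subtype_val)⟩
  obtain ⟨g, hg⟩ := exists_continuous_approx G (show 0 < ε / 4 by positivity)
  -- Error budget: `ε / 4` for the tail, `ε / 4` for `g`, and `2 * η * V ≤ ε / 2` for the projection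
  -- network and the perturbed pairings, each at most `η` pointwise.
  set η := ε / (4 * (V + 1)) with hη
  have hη0 : 0 < η := by positivity
  obtain ⟨k, m, ψ, a₂, b₂, A, B, b₃, c₃, hψ, hQ⟩ :=
    exists_pairNet_approx hC.continuous hσ.exists_ne hD.continuous hτ.2 hK R' g hη0
  obtain ⟨E, hE0, hE⟩ := exists_pairNet_lipschitz hC hD a₂ b₂ A B b₃ c₃
  obtain ⟨R, M, m₁, a₁, b₁, c₁, hR, hM, hN⟩ :=
    -- The Lipschitz constant `E` turns this accuracy into an output error of at most `η`.
    exists_scalarNet_pairing_approx hD.continuous hτ.2 hK hψ (show 0 < η / (E + 1) by positivity)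
  have hψb : ∀ l, ∃ C, ∀ x, |ψ l x| ≤ C := fun l =>
    (hψ l).2.exists_bound_of_continuous (hψ l).1
  obtain ⟨Ψ₀, hΨ₀, hΨ₀'⟩ := exists_isNeuralOperator σ hD.continuous (cube d R) R'
    (fun l => (hψ l).1) hψb a₁ b₁ c₁ a₂ b₂ A B b₃ c₃
  let S : L1On (cube d R) → L1On (cube d R) := (lipschitzWith_clip hM).compLp (clip_zero hM)
  have hS : ∀ f : L1On (cube d R), ∀ᵐ x ∂(volume.restrict (cube d R)), S f x = clip M (f x) :=
    fun f => (lipschitzWith_clip hM).coeFn_compLp (clip_zero hM) f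
  refine ⟨R, R', hR, hR', _, ⟨clip M, S, Ψ₀, isShallowReLU_clip M, hS, hΨ₀, rfl⟩, fun ρ hρ => ?_⟩
  simp only [Function.comp_apply]
  rw [norm_sub_zeroExtension]
  have hpair : ∀ l, ∫ x in cube d R, scalarNet τ a₁ b₁ c₁ (S (restriction (cube d R) ρ) x) * ψ l x
      = ∫ x in cube d R, scalarNet τ a₁ b₁ c₁ (clip M (ρ x)) * ψ l x := by
    intro l
    refine integral_congr_ae ?_
    filter_upwards [hS (restriction (cube d R) ρ), LpToLpRestrictCLM_coeFn ℝ (cube d R) ρ]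
      with x h1 h2
    rw [h1, restriction, h2]
  have hout : ‖BoundedContinuousFunction.toLp 1 (volume.restrict Ω') ℝ (g ⟨ρ, hρ⟩) -
      Ψ₀ (S (restriction (cube d R) ρ))‖ ≤ 2 * η * V := by
    rw [norm_L1_eq_integral_abs]
    have h : ∀ᵐ y ∂(volume.restrict Ω'),
        |(BoundedContinuousFunction.toLp 1 (volume.restrict Ω') ℝ (g ⟨ρ, hρ⟩) -
          Ψ₀ (S (restriction (cube d R) ρ)) : L1On Ω') y| ≤ 2 * η := by
      filter_upwards [Lp.coeFn_sub (BoundedContinuousFunction.toLp 1 (volume.restrict Ω') ℝ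
          (g ⟨ρ, hρ⟩)) (Ψ₀ (S (restriction (cube d R) ρ))),
        BoundedContinuousFunction.coeFn_toLp 1 (volume.restrict Ω') ℝ (g ⟨ρ, hρ⟩),
        hΨ₀' (S (restriction (cube d R) ρ)),
        ae_restrict_mem (measurableSet_cube d' R')] with y h1 h2 h3 h4
      rw [h1, Pi.sub_apply, h2, h3, abs_sub_comm]
      simp only [hpair]
      have h5 := hQ ⟨ρ, hρ⟩ y h4
      have h6 := hE y _ _ _ (hN ρ hρ)
      have h7 : E * (η / (E + 1)) ≤ η := by
        rw [mul_div_assoc', div_le_iff₀ (by positivity)]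
        linarith
      rw [abs_sub_comm] at h6
      have h8 := abs_sub_le (pairNet τ A B b₃ c₃ y fun l => σ (a₂ l *
        (∫ x in cube d R, scalarNet τ a₁ b₁ c₁ (clip M (ρ x)) * ψ l x) + b₂ l))
        (pairNet τ A B b₃ c₃ y fun l => σ (a₂ l * (∫ x, ρ x * ψ l x) + b₂ l)) (g ⟨ρ, hρ⟩ y)
      linarith
    refine (integral_mono_ae (L1.integrable_coeFn _).abs (integrable_const (2 * η)) h).trans ?_
    rw [integral_const, measureReal_restrict_apply_univ, smul_eq_mul, mul_comm]
  have h1 := norm_sub_le_norm_sub_add_norm_sub (restriction Ω' (F ρ))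
    (BoundedContinuousFunction.toLp 1 (volume.restrict Ω') ℝ (g ⟨ρ, hρ⟩))
    (Ψ₀ (S (restriction (cube d R) ρ)))
  have h2 : ‖restriction Ω' (F ρ) -
      BoundedContinuousFunction.toLp 1 (volume.restrict Ω') ℝ (g ⟨ρ, hρ⟩)‖ < ε / 4 := hg ⟨ρ, hρ⟩
  have h3 : 2 * η * V ≤ ε / 2 := by
    have : η * (4 * (V + 1)) = ε := div_mul_cancel₀ _ (by positivity)
    nlinarith
  have h4 := htail (F ρ) ⟨ρ, hρ, rfl⟩
  linarith
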